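/- Let $\mathbb{F}$ be a field with an involutive automorphism (for example $\mathbb{R}$ with the identity or $\mathbb{C}$ with complex conjugation), and let $A^*$ denote the corresponding conjugate transpose of a matrix $A$. *Circuits.* A linear arithmetic circuit with $n$ inputs and $n$ outputs over $\mathbb{F}$ is a directed acyclic graph whose nodes are the $n$ inputs and finitely many operation gates; each gate computes $\alpha X+\beta Y$ with constants $\alpha,\beta\in\mathbb{F}$, where $X,Y$ are inputs or results of earlier gates, and each output is the value of some node. Its size $s$ is the number of gates including the inputs, and its depth $d$ is the length of a longest directed path (inputs have depth $0$). *Butterfly matrices.* For $k\ge 2$ a power of $2$, a butterfly factor of size $k$ is a matrix $\begin{bmatrix}D_1&D_2\\D_3&D_4\end{bmatrix}$ with $\frac k2\times\frac k2$ diagonal blocks $D_i$. A butterfly factor matrix of size $N$ and block size $k$ is a block diagonal matrix of $N/k$ (possibly different) butterfly factors of size $k$. For $N$ a power of $2$, a butterfly matrix of size $N$ is a product $B_N B_{N/2}\cdots B_2$, where $B_k$ is a butterfly factor matrix of size $N$ and block size $k$ (the empty product, i.e. the identity, if $N=1$). Let $\mathcal{B}$ be the set of butterfly matrices, and let $\mathcal{B}\mathcal{B}^*$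 be the set of products $M_1M_2^*$ with $M_1,M_2\in\mathcal{B}$ of the same size. Let $(\mathcal{B}\mathcal{B}^*)^w$ be the set of products $M_w\cdots M_1$ of $w$ matrices of the same size in $\mathcal{B}\mathcal{B}^*$. For rational $e\ge 1$, let $(\mathcal{B}\mathcal{B}^*)^w_e$ be the set of $n\times n$ matrices of the form $S E S^{T}$, where $E\in(\mathcal{B}\mathcal{B}^*)^w$ has size $en\times en$ (so $en$ is an integer) and $S=[I_n\ 0\ \cdots\ 0]\in\mathbb{F}^{n\times en}$; that is, the upper-left $n\times n$ corners of such $E$. **Theorem.** There is an absolute constant $K$ such that the following holds for every such field $\mathbb{F}$ and every $n\ge 1$. Let $M\in\mathbb{F}^{n\times n}$ be a matrix such that the map $v\mapsto Mv$ is computed by a linear arithmetic circuit with $s$ gates (inputs included) and depth $d$. Then there are an integer $w$ with $1\le w\le K\max(1,d)$ and a rational $e\ge 1$ with $e\le K\,s/n$ such that $M\in(\mathcal{B}\mathcal{B}^*)^{w}_{e}$. In short, $M\in(\mathcal{B}\mathcal{B}^*)^{O(d)}_{O(s/n)}$. -/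

import Mathlib

/-! ### Linear arithmetic circuits -/

/-- A linear arithmetic circuit over `F` with `n` inputs and `n` outputs, given as a
straight-line program. It has `numGates` operation gates; gate `i` computes
`α i * X + β i * Y`, where each of its two operands `X = left i` and `Y = right i` is
an input of the circuit or the result of an earlier gate (fan-out is unbounded).
Every output is read off at some node, an input or a gate. -/
structure LinearCircuit (F : Type*) (n : ℕ) where
  numGates : ℕ
  left : (i : Fin numGates) → Fin n ⊕ Fin i.val
  right : (i : Fin numGates) → Fin n ⊕ Fin i.val
  α : Fin numGates → F
  β : Fin numGates → F
  out : Fin n → Fin n ⊕ Fin numGates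

namespace LinearCircuit

variable {F : Type*} {n : ℕ}

/-- The value computed at gate `i` on the input vector `v`. -/
def gateVal [Field F] (C : LinearCircuit F n) (v : Fin n → F) (i : Fin C.numGates) : F :=
  C.α i * (match C.left i with
    | Sum.inl j => v j
    | Sum.inr k => C.gateVal v ⟨k.val, k.isLt.trans i.isLt⟩) +
  C.β i * (match C.right i with
    | Sum.inl j => v j
    | Sum.inr k => C.gateVal v ⟨k.val, k.isLt.trans i.isLt⟩)
termination_by i.val
decreasing_by all_goals exact k.isLt

/-- The output vector of the circuit on the input vector `v`. -/
def eval [Field F] (C : LinearCircuit F n) (v : Fin n → F) : Fin n → F :=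
  fun i => Sum.elim v (C.gateVal v) (C.out i)

/-- The circuit computes the matrix-vector product `M v` for every vector `v`. -/
def Computes [Field F] (C : LinearCircuit F n) (M : Matrix (Fin n) (Fin n) F) : Prop :=
  ∀ v : Fin n → F, C.eval v = M.mulVec v

/-- The number of gates, inputs included. -/
def size (C : LinearCircuit F n) : ℕ := n + C.numGates

/-- The length of the longest directed path ending in gate `i` (inputs have depth `0`). -/
def gateDepth (C : LinearCircuit F n) (i : Fin C.numGates) : ℕ :=
  1 + max
    (match C.left i with
      | Sum.inl _ => 0
      | Sum.inr k => C.gateDepth ⟨k.val, k.isLt.trans i.isLt⟩)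
    (match C.right i with
      | Sum.inl _ => 0
      | Sum.inr k => C.gateDepth ⟨k.val, k.isLt.trans i.isLt⟩)
termination_by i.val
decreasing_by all_goals exact k.isLt

/-- The depth of the directed acyclic graph of the circuit. -/
def depth (C : LinearCircuit F n) : ℕ := Finset.univ.sup C.gateDepth

end LinearCircuit

/-! ### Butterfly matrices and the kaleidoscope hierarchy -/

namespace Kaleidoscope

variable {F : Type*} [Field F]

/-- A butterfly factor of size `h + h`: a matrix `[D₁ D₂; D₃ D₄]` whose four
`h × h` blocks are diagonal. -/
def IsButterflyFactor {h : ℕ} (B : Matrix (Fin (h + h)) (Fin (h + h)) F) : Prop :=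
  ∃ D₁ D₂ D₃ D₄ : Fin h → F,
    B = Matrix.reindex finSumFinEquiv finSumFinEquiv
      (Matrix.fromBlocks (Matrix.diagonal D₁) (Matrix.diagonal D₂)
        (Matrix.diagonal D₃) (Matrix.diagonal D₄))

/-- Position `x` of block number `b`, in `q` consecutive blocks of length `k`,
is the index `x + k * b`. -/
def blockIndex {k q N : ℕ} (hN : q * k = N) : Fin k × Fin q ≃ Fin N :=
  ((Equiv.prodComm _ _).trans finProdFinEquiv).trans (finCongr hN)

/-- A butterfly factor matrix of size `N` with block size `h + h`: a block diagonal
matrix of `N / (h + h)` (possibly different) butterfly factors of size `h + h`. -/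
def IsButterflyFactorMatrix (h : ℕ) {N : ℕ} (B : Matrix (Fin N) (Fin N) F) : Prop :=
  ∃ (q : ℕ) (hN : q * (h + h) = N) (D : Fin q → Matrix (Fin (h + h)) (Fin (h + h)) F),
    (∀ b, IsButterflyFactor (D b)) ∧
      B = Matrix.reindex (blockIndex hN) (blockIndex hN) (Matrix.blockDiagonal D)

/-- The set `𝓑` of butterfly matrices of size `N = 2 ^ m`: the products
`B_N * B_(N/2) * ⋯ * B_2`, where `B_k` is a butterfly factor matrix of block size `k`.
Below, `B l` has block size `2 ^ l + 2 ^ l = 2 ^ (l + 1)`. -/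
def Butterfly (F : Type*) [Field F] (N : ℕ) : Set (Matrix (Fin N) (Fin N) F) :=
  {M | ∃ m : ℕ, N = 2 ^ m ∧ ∃ B : Fin m → Matrix (Fin N) (Fin N) F,
    (∀ l : Fin m, IsButterflyFactorMatrix (2 ^ l.val) (B l)) ∧
      M = (List.ofFn B).reverse.prod}

/-- The set `𝓑𝓑*` in size `N`: the products `M₁ * M₂ᴴ` with `M₁`, `M₂` butterfly matrices. -/
def BBStar (F : Type*) [Field F] [StarRing F] (N : ℕ) : Set (Matrix (Fin N) (Fin N) F) :=
  {M | ∃ M₁ ∈ Butterfly F N, ∃ M₂ ∈ Butterfly F N, M = M₁ * M₂.conjTranspose}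

/-- The set `(𝓑𝓑*)^w` in size `N`: the products `M_w * ⋯ * M_1` of `w` elements of `𝓑𝓑*`. -/
def BBStarPow (F : Type*) [Field F] [StarRing F] (w N : ℕ) :
    Set (Matrix (Fin N) (Fin N) F) :=
  {M | ∃ A : Fin w → Matrix (Fin N) (Fin N) F,
    (∀ i, A i ∈ BBStar F N) ∧ M = (List.ofFn A).reverse.prod}

/-- The `n × N` matrix `S = [I_n 0 ⋯ 0]` (for `n ≤ N`). -/
def cornerMatrix (F : Type*) [Field F] (n N : ℕ) : Matrix (Fin n) (Fin N) F :=
  Matrix.of fun i j => if i.val = j.val then 1 else 0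

/-- The set `(𝓑𝓑*)^w_e` of `n × n` matrices: those of the form `S * E * Sᵀ`, where
`E ∈ (𝓑𝓑*)^w` has size `N × N` with `N = e * n ≥ n` and `S = [I_n 0 ⋯ 0]`. The expansion
factor `e` is rational, so that `e * n` can be a power of two for every `n`. -/
def KMatrix (F : Type*) [Field F] [StarRing F] (n w : ℕ) (e : ℚ) :
    Set (Matrix (Fin n) (Fin n) F) :=
  {M | ∃ N : ℕ, (N : ℚ) = e * n ∧ n ≤ N ∧ ∃ E ∈ BBStarPow F w N,
    M = cornerMatrix F n N * E * (cornerMatrix F n N).transpose}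

end Kaleidoscope

/-! A linear map whose matrix only connects indices differing in the bit of weight `2 ^ l` is a
butterfly factor matrix, so a butterfly matrix is one pass over all bits from the lowest to the
highest, and its adjoint a pass in the opposite order. Three facts then give the theorem.

* Every permutation matrix lies in `𝓑𝓑*` (`gather_perm_mem`). This is the Beneš network: a
  2-colouring of the indices, which separates the members of every outermost switch on both
  sides, decides which half of the network each index uses.
* A map `x ↦ x ∘ ψ` with `ψ` monotone and 1-Lipschitz lies in `𝓑*`
  (`exists_ladder_of_monotone`): this is conflict-free copying in a banyan network.
  Every `φ` is, up to permutations on both sides, such a `ψ`, so that every map `x ↦ x ∘ φ`,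
  with arbitrary repetitions, lies in `(𝓑𝓑*)^3` (`gather_mem`).
* Hence if `N` is at least twice the circuit size, the map that recomputes all gates of the
  circuit at once from the present values of their operands lies in `(𝓑𝓑*)^4`: gather the left
  operands into one half and the right operands into the other half, and combine
  them with one factor of block size `N` (`exists_combination`).

After `d` repetitions of this last map all gates of depth at most `d` are correct, whatever the
initial contents of their positions, and a final gathering step reads off the outputs
(`exists_simulation`). -/

namespace Kaleidoscope

/-! ### Butterfly factor matrices through their support -/

/-- Two indices meet in the same switch of level `l`: their binary expansions agree except
possibly in the bit of weight `2 ^ l`. -/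
def SameSwitch (l i j : ℕ) : Prop :=
  i / 2 ^ (l + 1) = j / 2 ^ (l + 1) ∧ i % 2 ^ l = j % 2 ^ l

lemma SameSwitch.symm {l i j : ℕ} (h : SameSwitch l i j) : SameSwitch l j i :=
  ⟨h.1.symm, h.2.symm⟩

/-- The matrix connects only indices that meet in a switch of level `l`. -/
def IsSwitchMatrix {F : Type*} [Field F] {N : ℕ} (l : ℕ) (B : Matrix (Fin N) (Fin N) F) : Prop :=
  ∀ i j : Fin N, B i j ≠ 0 → SameSwitch l i j

lemma IsSwitchMatrix.one {F : Type*} [Field F] {N : ℕ} (l : ℕ) :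
    IsSwitchMatrix l (1 : Matrix (Fin N) (Fin N) F) := by
  intro i j h
  have : i = j := by
    by_contra hij
    exact h (Matrix.one_apply_ne hij)
  exact this ▸ ⟨rfl, rfl⟩

lemma IsSwitchMatrix.conjTranspose {F : Type*} [Field F] [StarRing F] {N l : ℕ}
    {B : Matrix (Fin N) (Fin N) F} (hB : IsSwitchMatrix l B) :
    IsSwitchMatrix l B.conjTranspose := by
  intro i j h
  refine (hB j i fun h0 => h ?_).symm
  rw [Matrix.conjTranspose_apply, h0, star_zero]

lemma blockIndex_val {k q N : ℕ} (hN : q * k = N) (x : Fin k) (b : Fin q) :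
    (blockIndex hN (x, b) : ℕ) = x + k * b := by
  simp [blockIndex]

lemma IsSwitchMatrix.isButterflyFactorMatrix {F : Type*} [Field F] {m l : ℕ} (hl : l < m)
    {B : Matrix (Fin (2 ^ m)) (Fin (2 ^ m)) F} (hB : IsSwitchMatrix l B) :
    IsButterflyFactorMatrix (2 ^ l) B := by
  have hN : 2 ^ (m - l - 1) * (2 ^ l + 2 ^ l) = 2 ^ m := by
    rw [← two_mul, ← pow_succ', ← pow_add]
    congr 1
    omega
  have hpos : 0 < 2 ^ l := by positivity
  refine ⟨2 ^ (m - l - 1), hN,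
    fun b => Matrix.of fun x y => B (blockIndex hN (x, b)) (blockIndex hN (y, b)), ?_, ?_⟩
  · intro b
    refine ⟨fun x => B (blockIndex hN (Fin.castAdd _ x, b)) (blockIndex hN (Fin.castAdd _ x, b)),
      fun x => B (blockIndex hN (Fin.castAdd _ x, b)) (blockIndex hN (Fin.natAdd _ x, b)),
      fun x => B (blockIndex hN (Fin.natAdd _ x, b)) (blockIndex hN (Fin.castAdd _ x, b)),
      fun x => B (blockIndex hN (Fin.natAdd _ x, b)) (blockIndex hN (Fin.natAdd _ x, b)), ?_⟩
    have hmod : ∀ x y : Fin (2 ^ l + 2 ^ l), (x : ℕ) % 2 ^ l ≠ y % 2 ^ l →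
        B (blockIndex hN (x, b)) (blockIndex hN (y, b)) = 0 := by
      intro x y hxy
      by_contra h
      apply hxy
      have := (hB _ _ h).2
      rw [blockIndex_val, blockIndex_val, add_mul, ← mul_add] at this
      simpa only [Nat.add_mul_mod_self_left] using this
    have hne : ∀ x y : Fin (2 ^ l), x ≠ y → (x : ℕ) % 2 ^ l ≠ y % 2 ^ l := by
      intro x y hxy h
      rw [Nat.mod_eq_of_lt x.2, Nat.mod_eq_of_lt y.2] at h
      exact hxy (Fin.ext h)
    ext x y
    obtain ⟨x, rfl⟩ := finSumFinEquiv.surjective x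
    obtain ⟨y, rfl⟩ := finSumFinEquiv.surjective y
    rw [Matrix.reindex_apply, Matrix.submatrix_apply, Equiv.symm_apply_apply,
      Equiv.symm_apply_apply]
    rcases x with x | x <;> rcases y with y | y <;> by_cases hxy : x = y
    all_goals
      simp only [finSumFinEquiv_apply_left, finSumFinEquiv_apply_right, Matrix.of_apply,
        Matrix.fromBlocks_apply₁₁, Matrix.fromBlocks_apply₁₂, Matrix.fromBlocks_apply₂₁,
        Matrix.fromBlocks_apply₂₂]
    all_goals first
      | rw [hxy, Matrix.diagonal_apply_eq]
      | rw [Matrix.diagonal_apply_ne _ hxy]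
        exact hmod _ _ (by simpa using hne x y hxy)
  · ext i j
    obtain ⟨⟨x, b⟩, rfl⟩ := (blockIndex hN).surjective i
    obtain ⟨⟨y, c⟩, rfl⟩ := (blockIndex hN).surjective j
    rw [Matrix.reindex_apply, Matrix.submatrix_apply, Equiv.symm_apply_apply,
      Equiv.symm_apply_apply, Matrix.blockDiagonal_apply]
    split_ifs with hbc
    · obtain rfl : b = c := hbc
      rfl
    · by_contra h
      apply hbc
      have := (hB _ _ h).1
      rw [blockIndex_val, blockIndex_val, pow_succ, mul_two,
        Nat.add_mul_div_left _ _ (by omega), Nat.add_mul_div_left _ _ (by omega),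
        Nat.div_eq_of_lt x.2, Nat.div_eq_of_lt y.2] at this
      exact Fin.ext (by simpa using this)

/-! ### Products of switch matrices -/

/-- `Ladder k A` says that `A` is a product `T (k - 1) * ⋯ * T 1 * T 0` of switch matrices,
one for each level below `k`. -/
inductive Ladder {F : Type*} [Field F] {N : ℕ} : ℕ → Matrix (Fin N) (Fin N) F → Prop
  | zero : Ladder 0 1
  | succ {k : ℕ} {T A : Matrix (Fin N) (Fin N) F} :
      IsSwitchMatrix k T → Ladder k A → Ladder (k + 1) (T * A)

lemma Ladder.exists_list {F : Type*} [Field F] {N k : ℕ} {A : Matrix (Fin N) (Fin N) F}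
    (hA : Ladder k A) : ∃ T : Fin k → Matrix (Fin N) (Fin N) F,
      (∀ l : Fin k, IsSwitchMatrix l (T l)) ∧ A = (List.ofFn T).reverse.prod := by
  induction hA with
  | zero => exact ⟨Fin.elim0, fun l => l.elim0, by simp⟩
  | @succ k T A hT _ ih =>
    obtain ⟨S, hS, rfl⟩ := ih
    refine ⟨Fin.snoc S T, fun l => ?_, ?_⟩
    · induction l using Fin.lastCases with
      | last => simpa using hT
      | cast l => simpa using hS l
    · rw [List.ofFn_succ']
      simp

lemma Ladder.mem_butterfly {F : Type*} [Field F] {m : ℕ}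
    {A : Matrix (Fin (2 ^ m)) (Fin (2 ^ m)) F} (hA : Ladder m A) : A ∈ Butterfly F (2 ^ m) := by
  obtain ⟨T, hT, rfl⟩ := hA.exists_list
  exact ⟨m, rfl, T, fun l => (hT l).isButterflyFactorMatrix l.2, rfl⟩

lemma Ladder.one {F : Type*} [Field F] {N : ℕ} (k : ℕ) :
    Ladder k (1 : Matrix (Fin N) (Fin N) F) := by
  induction k with
  | zero => exact .zero
  | succ k ih => simpa using Ladder.succ (.one k) ih

lemma Ladder.mul_conjTranspose_mem {F : Type*} [Field F] [StarRing F] {m : ℕ}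
    {A B : Matrix (Fin (2 ^ m)) (Fin (2 ^ m)) F} (hA : Ladder m A) (hB : Ladder m B) :
    A * B.conjTranspose ∈ BBStar F (2 ^ m) :=
  ⟨A, hA.mem_butterfly, B, hB.mem_butterfly, rfl⟩

lemma BBStarPow.mul {F : Type*} [Field F] [StarRing F] {N v w : ℕ}
    {A B : Matrix (Fin N) (Fin N) F} (hA : A ∈ BBStarPow F v N) (hB : B ∈ BBStarPow F w N) :
    A * B ∈ BBStarPow F (w + v) N := by
  obtain ⟨S, hS, rfl⟩ := hA
  obtain ⟨T, hT, rfl⟩ := hB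
  refine ⟨Fin.append T S, fun i => ?_, ?_⟩
  · induction i using Fin.addCases with
    | left i => simpa using hT i
    | right i => simpa using hS i
  · rw [List.ofFn_fin_append, List.reverse_append, List.prod_append]

lemma BBStarPow.of_mem {F : Type*} [Field F] [StarRing F] {N : ℕ}
    {A : Matrix (Fin N) (Fin N) F} (hA : A ∈ BBStar F N) : A ∈ BBStarPow F 1 N :=
  ⟨fun _ => A, fun _ => hA, by simp⟩

lemma BBStarPow.pow {F : Type*} [Field F] [StarRing F] {N w : ℕ}
    {A : Matrix (Fin N) (Fin N) F} (hA : A ∈ BBStarPow F w N) (d : ℕ) :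
    A ^ d ∈ BBStarPow F (w * d) N := by
  induction d with
  | zero => exact ⟨Fin.elim0, fun i => i.elim0, by simp⟩
  | succ d ih => simpa [pow_succ', mul_add] using BBStarPow.mul hA ih

/-! ### Gather matrices -/

/-- The matrix of the linear map `x ↦ x ∘ φ`. -/
def gather (F : Type*) [Field F] {N : ℕ} (φ : Fin N → Fin N) : Matrix (Fin N) (Fin N) F :=
  Matrix.of fun i j => if φ i = j then 1 else 0

lemma gather_mulVec {F : Type*} [Field F] {N : ℕ} (φ : Fin N → Fin N) (x : Fin N → F) :
    (gather F φ).mulVec x = x ∘ φ := by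
  ext i
  simp [gather, Matrix.mulVec, dotProduct]

lemma gather_mul {F : Type*} [Field F] {N : ℕ} (φ ψ : Fin N → Fin N) :
    gather F φ * gather F ψ = gather F (ψ ∘ φ) := by
  ext i j
  simp only [gather, Matrix.mul_apply, Matrix.of_apply, ite_mul, one_mul, zero_mul]
  simp

lemma gather_id {F : Type*} [Field F] {N : ℕ} : gather F (id : Fin N → Fin N) = 1 := by
  ext i j
  simp [gather, Matrix.one_apply]

lemma isSwitchMatrix_gather {F : Type*} [Field F] {N l : ℕ} {φ : Fin N → Fin N}
    (h : ∀ i : Fin N, SameSwitch l i (φ i)) : IsSwitchMatrix l (gather F φ) := by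
  intro i j hij
  have : φ i = j := by
    by_contra hne
    exact hij (by simp [gather, hne])
  exact this ▸ h i

/-! ### Permutations: the Beneš network -/

/-- Two fixed-point-free involutions `a`, `b` have a common proper 2-colouring. The product
`a * b` has the property that `x` and `a x` always lie in different cycles, and `a` carries
cycles to cycles, so that one may colour the cycles. -/
lemma exists_two_colouring {X : Type*} (a b : Equiv.Perm X) (ha : ∀ x, a (a x) = x)
    (hb : ∀ x, b (b x) = x) (ha' : ∀ x, a x ≠ x) (hb' : ∀ x, b x ≠ x) :
    ∃ c : X → Bool, (∀ x, c (a x) = !c x) ∧ ∀ x, c (b x) = !c x := by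
  classical
  have haa : a * a = 1 := Equiv.ext ha
  have hbb : b * b = 1 := Equiv.ext hb
  have hai : a⁻¹ = a := inv_eq_of_mul_eq_one_left haa
  have hbi : b⁻¹ = b := inv_eq_of_mul_eq_one_left hbb
  set p : Equiv.Perm X := a * b with hp
  have hconj : a * p * a⁻¹ = p⁻¹ := by
    rw [hp, mul_inv_rev, hai, hbi, ← mul_assoc, haa, one_mul]
  have hconjz (k : ℤ) (x : X) : a ((p ^ k) x) = (p ^ (-k)) (a x) := by
    have : a * p ^ k * a⁻¹ = p ^ (-k) := by rw [← conj_zpow, hconj, inv_zpow', ]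
    rw [← this]
    simp
  have hcycle (x : X) : ¬ p.SameCycle x (a x) := by
    rintro ⟨k, hk⟩
    obtain ⟨j, rfl | rfl⟩ := Int.even_or_odd' k
    · -- `a` would fix `p ^ j x`
      apply ha' ((p ^ j) x)
      rw [hconjz, ← hk, ← Equiv.Perm.mul_apply, ← zpow_add]
      congr 2
      ring
    · -- `b` would fix `p ^ j x`
      apply hb' ((p ^ j) x)
      apply a.injective
      have : a (b ((p ^ j) x)) = (p ^ (1 + j)) x := by
        rw [zpow_add, zpow_one]
        rfl
      rw [this, hconjz, ← hk, ← Equiv.Perm.mul_apply, ← zpow_add]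
      congr 2
      ring
  let f : X → Quotient (Equiv.Perm.SameCycle.setoid p) := fun x => Quotient.mk _ x
  have hf {x y : X} : f x = f y ↔ p.SameCycle x y := Quotient.eq
  obtain ⟨r, hr⟩ := exists_wellFoundedLT (Quotient (Equiv.Perm.SameCycle.setoid p))
  have hca (x : X) : decide (f (a x) < f (a (a x))) = !decide (f x < f (a x)) := by
    have hne : f x ≠ f (a x) := fun h => hcycle x (hf.1 h)
    rw [ha]
    rcases lt_or_gt_of_ne hne with h | h
    · simp [h, h.le]
    · simp [h, h.le]
  refine ⟨fun x => decide (f x < f (a x)), hca, fun x => ?_⟩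
  -- `b x = a (p x)`, and `x`, `p x` have the same colour
  have hbx : b x = a (p x) := by rw [hp, Equiv.Perm.mul_apply, ha]
  have h1 : f (p x) = f x := hf.2 ⟨-1, by simp⟩
  have h2 : f (a (p x)) = f (a x) := hf.2 ⟨1, by
    have := hconjz 1 x
    rw [zpow_one] at this
    rw [this]
    simp⟩
  simp only [hbx]
  rw [hca, h1, h2]

/-- The partner of an index in its switch of level `k`: the bit of weight `2 ^ k` is flipped. -/
def flipBit {m k : ℕ} (hk : k < m) : Equiv.Perm (Fin (2 ^ m)) :=
  Function.Involutive.toPerm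
    (fun i => ⟨i ^^^ 2 ^ k, Nat.xor_lt_two_pow i.2 (Nat.pow_lt_pow_right one_lt_two hk)⟩)
    (fun i => Fin.ext (by simp))

lemma flipBit_val {m k : ℕ} (hk : k < m) (i : Fin (2 ^ m)) :
    (flipBit hk i : ℕ) = i ^^^ 2 ^ k := rfl

lemma flipBit_flipBit {m k : ℕ} (hk : k < m) (i : Fin (2 ^ m)) :
    flipBit hk (flipBit hk i) = i :=
  Fin.ext (by simp [flipBit_val])

lemma testBit_flipBit {m k : ℕ} (hk : k < m) (i : Fin (2 ^ m)) (t : ℕ) :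
    (flipBit hk i : ℕ).testBit t = ((i : ℕ).testBit t ^^ decide (k = t)) := by
  simp [flipBit_val, Nat.testBit_two_pow]

lemma sameSwitch_iff_testBit {l i j : ℕ} :
    SameSwitch l i j ↔ ∀ t, t ≠ l → i.testBit t = j.testBit t := by
  constructor
  · rintro ⟨h1, h2⟩ t ht
    rcases lt_or_gt_of_ne ht with h | h
    · have := congrArg (fun z => z.testBit t) h2
      simpa [Nat.testBit_mod_two_pow, h] using this
    · have := congrArg (fun z => z.testBit (t - (l + 1))) h1
      simpa [Nat.testBit_div_two_pow, Nat.sub_add_cancel h] using this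
  · intro h
    constructor
    · apply Nat.eq_of_testBit_eq
      intro t
      simpa [Nat.testBit_div_two_pow] using h _ (by omega)
    · apply Nat.eq_of_testBit_eq
      intro t
      by_cases ht : t < l
      · simpa [Nat.testBit_mod_two_pow, ht] using h t (by omega)
      · simp [Nat.testBit_mod_two_pow, ht]

lemma div_two_pow_eq_iff_testBit {k i j : ℕ} :
    i / 2 ^ k = j / 2 ^ k ↔ ∀ t, k ≤ t → i.testBit t = j.testBit t := by
  constructor
  · intro h t ht
    have := congrArg (fun z => z.testBit (t - k)) h
    simpa [Nat.testBit_div_two_pow, Nat.sub_add_cancel ht] using this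
  · intro h
    apply Nat.eq_of_testBit_eq
    intro t
    simpa [Nat.testBit_div_two_pow] using h _ (by omega)

/-- A colouring that separates the two members of each switch is realized by a setting of the
switches of level `k`: the member of colour `true` goes to the position whose bit is `1`. -/
lemma exists_switch_setting {m k : ℕ} (hk : k < m) (c : Fin (2 ^ m) → Bool)
    (hc : ∀ x, c (flipBit hk x) = !c x) :
    ∃ s : Equiv.Perm (Fin (2 ^ m)), (∀ x, s (s x) = x) ∧ (∀ x : Fin (2 ^ m), SameSwitch k x (s x)) ∧
      ∀ x, (s x : ℕ).testBit k = c x := by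
  let s : Fin (2 ^ m) → Fin (2 ^ m) := fun x =>
    if (x : ℕ).testBit k = c x then x else flipBit hk x
  have hs : Function.Involutive s := by
    intro x
    by_cases h : (x : ℕ).testBit k = c x
    · simp [s, h]
    · have h' : ¬ (flipBit hk x : ℕ).testBit k = c (flipBit hk x) := by
        simpa [testBit_flipBit, hc] using h
      simp [s, h, h', flipBit_flipBit]
  refine ⟨hs.toPerm, hs, fun x => ?_, fun x => ?_⟩
  · rw [sameSwitch_iff_testBit]
    intro t ht
    by_cases h : (x : ℕ).testBit k = c x
    · simp [s, h]
    · simp [s, h, testBit_flipBit, ht.symm]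
  · by_cases h : (x : ℕ).testBit k = c x
    · simp [s, h]
    · have h' : (x : ℕ).testBit k = !c x := Bool.eq_not_of_ne h
      simp [s, h', testBit_flipBit]

lemma ne_flipBit {m k : ℕ} (hk : k < m) (x : Fin (2 ^ m)) : flipBit hk x ≠ x := by
  intro h
  have := testBit_flipBit hk x k
  rw [h] at this
  simp at this

/-- A permutation that stabilizes the blocks of length `2 ^ k` is realized by the switches of
the levels `k - 1, …, 0, 0, …, k - 1`. The two outer levels are set by a 2-colouring of the
indices that separates both the members of every input switch and those of every output
switch; what remains stabilizes the blocks of half the length. -/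
lemma exists_ladder_of_blockPreserving {F : Type*} [Field F] [StarRing F] {m k : ℕ} (hk : k ≤ m)
    (σ : Equiv.Perm (Fin (2 ^ m))) (hσ : ∀ i, (σ i : ℕ) / 2 ^ k = i / 2 ^ k) :
    ∃ A B : Matrix (Fin (2 ^ m)) (Fin (2 ^ m)) F, Ladder k A ∧ Ladder k B ∧
      gather F σ = A * B.conjTranspose := by
  induction k generalizing σ with
  | zero =>
    refine ⟨1, 1, .zero, .zero, ?_⟩
    have : σ = 1 := by
      ext i
      simpa using hσ i
    rw [this, Equiv.Perm.coe_one, gather_id]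
    simp
  | succ k ih =>
    have hk' : k < m := hk
    obtain ⟨c, hc, hc'⟩ := exists_two_colouring (flipBit hk') (σ⁻¹ * flipBit hk' * σ)
      (flipBit_flipBit hk') (fun x => by simp [flipBit_flipBit]) (ne_flipBit hk') (fun x h => ne_flipBit hk' (σ x) (by
        have := congrArg σ h
        simpa using this))
    obtain ⟨s, hss, hs, hsc⟩ := exists_switch_setting hk' c hc
    obtain ⟨t, htt, ht, htc⟩ := exists_switch_setting hk' (fun y => c (σ⁻¹ y)) (fun y => by
      simpa using hc' (σ⁻¹ y))
    -- `t ∘ σ ∘ s` keeps the bit of weight `2 ^ k`, which on both sides is the colour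
    have hτ (i) : ((s.trans (σ.trans t)) i : ℕ) / 2 ^ k = i / 2 ^ k := by
      rw [div_two_pow_eq_iff_testBit]
      intro b hb
      rcases hb.eq_or_lt with rfl | hb
      · have h1 := htc (σ (s i))
        have h2 := hsc (s i)
        rw [hss] at h2
        simpa [h2] using h1
      · have h1 := sameSwitch_iff_testBit.1 (ht (σ (s i))) b hb.ne'
        have h2 := div_two_pow_eq_iff_testBit.1 (hσ (s i)) b hb
        have h3 := sameSwitch_iff_testBit.1 (hs i) b hb.ne'
        simp only [Equiv.trans_apply]
        rw [← h1, h2, h3]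
    obtain ⟨A, B, hA, hB, hAB⟩ := ih hk'.le _ hτ
    refine ⟨gather F s * A, (gather F t).conjTranspose * B, .succ (isSwitchMatrix_gather hs) hA,
      .succ (isSwitchMatrix_gather ht).conjTranspose hB, ?_⟩
    rw [Matrix.conjTranspose_mul, Matrix.conjTranspose_conjTranspose, mul_assoc, ← mul_assoc A,
      ← hAB, gather_mul, gather_mul]
    congr 1
    ext x
    simp [hss, htt]

lemma gather_perm_mem {F : Type*} [Field F] [StarRing F] {m : ℕ} (σ : Equiv.Perm (Fin (2 ^ m))) :
    gather F σ ∈ BBStar F (2 ^ m) := by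
  obtain ⟨A, B, hA, hB, h⟩ := exists_ladder_of_blockPreserving (F := F) le_rfl σ fun i => by
    rw [Nat.div_eq_of_lt (σ i).2, Nat.div_eq_of_lt i.2]
  exact h ▸ hA.mul_conjTranspose_mem hB

/-! ### Monotone copying -/

/-- A monotone 1-Lipschitz `ψ` copies along the transposed butterfly network, coarse levels
first. The value meant for position `i` is always at a position that has the high bits of `i`
and the low bits of its source `ψ i`. There is no conflict since `ψ` maps a block of length
`2 ^ l` into an interval of length `2 ^ l`, whose elements are determined by their `l` low
bits. -/
lemma exists_ladder_of_monotone {F : Type*} [Field F] [StarRing F] {m : ℕ}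
    (ψ : Fin (2 ^ m) → Fin (2 ^ m)) (hmono : Monotone ψ)
    (hlip : ∀ i j, i ≤ j → (ψ j : ℕ) ≤ ψ i + (j - i)) :
    ∃ A : Matrix (Fin (2 ^ m)) (Fin (2 ^ m)) F, Ladder m A ∧ gather F ψ = A.conjTranspose := by
  have start_lt (l : ℕ) (p : Fin (2 ^ m)) : 2 ^ l * ((p : ℕ) / 2 ^ l) < 2 ^ m :=
    (Nat.mul_div_le _ _).trans_lt p.2
  -- `v l p` is the source that agrees with `p` in the `l` low bits, among the `2 ^ l` candidates
  -- from the image of the first index of the block of `p` on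
  let a : ℕ → Fin (2 ^ m) → ℕ := fun l p => ψ ⟨2 ^ l * ((p : ℕ) / 2 ^ l), start_lt l p⟩
  let v : ℕ → Fin (2 ^ m) → ℤ := fun l p => a l p + ((p : ℤ) - a l p) % (2 ^ l : ℕ)
  have hpow (l : ℕ) : (0 : ℤ) < (2 ^ l : ℕ) := by positivity
  have hav (l p) : (a l p : ℤ) ≤ v l p :=
    le_add_of_nonneg_right (Int.emod_nonneg _ (hpow l).ne')
  have hva (l p) : v l p < a l p + (2 ^ l : ℕ) :=
    add_lt_add_right (Int.emod_lt_of_pos _ (hpow l)) _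
  have hvmod (l p) : v l p % (2 ^ l : ℕ) = (p : ℤ) % (2 ^ l : ℕ) := by
    simp only [v, Int.add_emod_emod]
    congr 1
    ring
  have hunique (l p) (z : ℤ) (h1 : (a l p : ℤ) ≤ z) (h2 : z < a l p + (2 ^ l : ℕ))
      (h3 : z % (2 ^ l : ℕ) = (p : ℤ) % (2 ^ l : ℕ)) : v l p = z := by
    have : ((p : ℤ) - a l p) % (2 ^ l : ℕ) = z - a l p := by
      rw [Int.sub_emod, ← h3, ← Int.sub_emod]
      exact Int.emod_eq_of_lt (by omega) (by omega)
    simp only [v, this]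
    ring
  let g : ℕ → Fin (2 ^ m) → Fin (2 ^ m) := fun l p =>
    ⟨(v l p).toNat % 2 ^ m, Nat.mod_lt _ (by positivity)⟩
  have hg0 : g 0 = ψ := by
    ext p
    have h0 : a 0 p = ψ p := by simp [a]
    have h1 : v 0 p = ψ p := by simp [v, h0]
    simp [g, h1, Nat.mod_eq_of_lt (ψ p).2]
  have hgm : g m = id := by
    ext p
    have h1 := hvmod m p
    have h0 := hav m p
    lift v m p to ℕ using by omega with z hz
    have h2 : (v m p).toNat % 2 ^ m = (p : ℕ) % 2 ^ m := by
      rw [← hz, Int.toNat_natCast]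
      exact_mod_cast h1
    simpa [g, Nat.mod_eq_of_lt p.2] using h2
  have hstep (l : ℕ) (hl : l < m) : ∃ q : Fin (2 ^ m) → Fin (2 ^ m),
      (∀ p : Fin (2 ^ m), SameSwitch l p (q p)) ∧ g l = g (l + 1) ∘ q := by
    have hdvd : 2 ^ (l + 1) ∣ 2 ^ m := pow_dvd_pow 2 hl
    have hq (p : Fin (2 ^ m)) : 2 ^ (l + 1) * ((p : ℕ) / 2 ^ (l + 1)) +
        (v l p).toNat % 2 ^ (l + 1) < 2 ^ m := by
      obtain ⟨c, hc⟩ := hdvd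
      have h1 : (p : ℕ) / 2 ^ (l + 1) < c := by
        rw [Nat.div_lt_iff_lt_mul (by positivity), mul_comm, ← hc]
        exact p.2
      have h2 : (v l p).toNat % 2 ^ (l + 1) < 2 ^ (l + 1) := Nat.mod_lt _ (by positivity)
      calc _ < 2 ^ (l + 1) * ((p : ℕ) / 2 ^ (l + 1)) + 2 ^ (l + 1) := by omega
        _ = 2 ^ (l + 1) * ((p : ℕ) / 2 ^ (l + 1) + 1) := by ring
        _ ≤ 2 ^ (l + 1) * c := Nat.mul_le_mul_left _ h1
        _ = 2 ^ m := hc.symm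
    let q : Fin (2 ^ m) → Fin (2 ^ m) := fun p => ⟨_, hq p⟩
    have hqdiv (p) : (q p : ℕ) / 2 ^ (l + 1) = (p : ℕ) / 2 ^ (l + 1) := by
      simp only [q]
      rw [Nat.mul_add_div (by positivity), Nat.div_eq_of_lt (Nat.mod_lt _ (by positivity)),
        add_zero]
    have hqmod (p) : (q p : ℕ) % 2 ^ (l + 1) = (v l p).toNat % 2 ^ (l + 1) := by
      simp [q]
    have hvnat (p) : ((v l p).toNat : ℤ) = v l p :=
      Int.toNat_of_nonneg ((Int.natCast_nonneg _).trans (hav l p))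
    refine ⟨q, fun p => ⟨(hqdiv p).symm, ?_⟩, ?_⟩
    · have h1 := congrArg (· % 2 ^ l) (hqmod p)
      have h2 : 2 ^ l ∣ 2 ^ (l + 1) := pow_dvd_pow 2 l.le_succ
      simp only [Nat.mod_mod_of_dvd _ h2] at h1
      rw [h1]
      have h3 := hvmod l p
      rw [← hvnat] at h3
      exact_mod_cast h3.symm
    · -- the candidates of `p` at level `l` are among those of its block at level `l + 1`
      have hblock (p : Fin (2 ^ m)) : (p : ℕ) / 2 ^ (l + 1) = (p : ℕ) / 2 ^ l / 2 := by
        rw [pow_succ, Nat.div_div_eq_div_mul]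
      have haq (p) : a (l + 1) (q p) = a (l + 1) p := by
        simp only [a, hqdiv]
      have hlow (p : Fin (2 ^ m)) :
          2 ^ (l + 1) * ((p : ℕ) / 2 ^ (l + 1)) ≤ 2 ^ l * ((p : ℕ) / 2 ^ l) := by
        rw [hblock, pow_succ, mul_assoc]
        exact Nat.mul_le_mul_left _ (by omega)
      have hupp (p : Fin (2 ^ m)) :
          2 ^ l * ((p : ℕ) / 2 ^ l) ≤ 2 ^ (l + 1) * ((p : ℕ) / 2 ^ (l + 1)) + 2 ^ l := by
        rw [hblock, pow_succ, mul_assoc, ← Nat.mul_succ]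
        exact Nat.mul_le_mul_left _ (by omega)
      have ha1 (p) : a (l + 1) p ≤ a l p := hmono (hlow p)
      have ha2 (p) : a l p ≤ a (l + 1) p + 2 ^ l := by
        refine (hlip _ _ (hlow p)).trans (Nat.add_le_add_left ?_ _)
        have := hupp p
        simp only
        omega
      ext p
      have hv : v (l + 1) (q p) = v l p := by
        have h1 := ha1 p
        have h2 := ha2 p
        have h3 := hav l p
        have h4 := hva l p
        have h5 : (2 : ℕ) ^ (l + 1) = 2 ^ l + 2 ^ l := by ring
        apply hunique
        · rw [haq]
          omega
        · rw [haq, h5]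
          push_cast at h4 ⊢
          have h2' : (a l p : ℤ) ≤ a (l + 1) p + 2 ^ l := by exact_mod_cast h2
          linarith
        · rw [← hvnat]
          exact_mod_cast (hqmod p).symm
      simp [g, hv]
  have key (k : ℕ) (hk : k ≤ m) : ∃ A : Matrix (Fin (2 ^ m)) (Fin (2 ^ m)) F, Ladder k A ∧
      gather F ψ = A.conjTranspose * gather F (g k) := by
    induction k with
    | zero => exact ⟨1, .zero, by simp [hg0]⟩
    | succ k ih =>
      obtain ⟨A, hA, h⟩ := ih (by omega)
      obtain ⟨q, hq, hgq⟩ := hstep k hk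
      refine ⟨(gather F q).conjTranspose * A,
        .succ (isSwitchMatrix_gather hq).conjTranspose hA, ?_⟩
      rw [h, hgq, ← gather_mul, Matrix.conjTranspose_mul, Matrix.conjTranspose_conjTranspose,
        mul_assoc]
  obtain ⟨A, hA, h⟩ := key m le_rfl
  exact ⟨A, hA, by rw [h, hgm, gather_id, mul_one]⟩

/-- Every monotone map of `Fin N` is a monotone 1-Lipschitz map (the rank of the value among
all values taken) followed by a permutation. -/
lemma exists_perm_comp_lipschitz {N : ℕ} (χ : Fin N → Fin N) (hχ : Monotone χ) :
    ∃ (ρ : Equiv.Perm (Fin N)) (ψ : Fin N → Fin N), Monotone ψ ∧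
      (∀ i j, i ≤ j → (ψ j : ℕ) ≤ ψ i + (j - i)) ∧ χ = ρ ∘ ψ := by
  classical
  let r : Fin N → Finset (Fin N) := fun i => (Finset.univ.image χ).filter (· < χ i)
  have hlt {i j} (h : χ i < χ j) : (r i).card < (r j).card := by
    apply Finset.card_lt_card
    refine (Finset.ssubset_iff_of_subset ?_).2 ⟨χ i, by simp [r, h], by simp [r]⟩
    intro x hx
    simp only [r, Finset.mem_filter] at hx ⊢
    exact ⟨hx.1, hx.2.trans h⟩
  have hrN (i) : (r i).card < N := by
    have : (r i).card < (Finset.univ : Finset (Fin N)).card :=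
      Finset.card_lt_card ((Finset.ssubset_iff_of_subset (Finset.subset_univ _)).2
        ⟨χ i, Finset.mem_univ _, by simp [r]⟩)
    simpa using this
  let ψ : Fin N → Fin N := fun i => ⟨(r i).card, hrN i⟩
  have hψ {i j} (h : ψ i = ψ j) : χ i = χ j := by
    have h' : (r i).card = (r j).card := congrArg Fin.val h
    by_contra hne
    rcases lt_or_gt_of_ne hne with hc | hc
    · exact (hlt hc).ne h'
    · exact (hlt hc).ne' h'
  have hψ' {i j} (h : χ i = χ j) : ψ i = ψ j := by simp [ψ, r, h]
  have hex : ∀ y, ∃ x, y ∈ Set.range ψ → ∃ i, ψ i = y ∧ χ i = x := by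
    intro y
    by_cases hy : y ∈ Set.range ψ
    · obtain ⟨i, rfl⟩ := hy
      exact ⟨χ i, fun _ => ⟨i, rfl, rfl⟩⟩
    · exact ⟨y, fun h => absurd h hy⟩
  -- `f` sends the rank of a value to the value, and has to be extended to a permutation
  choose f hf using hex
  have hfψ (i) : f (ψ i) = χ i := by
    obtain ⟨j, hj, hj'⟩ := hf (ψ i) ⟨i, rfl⟩
    rw [← hj', hψ hj]
  obtain ⟨ρ, hρ⟩ := Finset.exists_equiv_extend_of_card_eq (α := Fin N)
    (t := (Finset.univ : Finset (Fin N))) (by simp) (s := Finset.univ.image ψ) (f := f)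
    (Finset.subset_univ _) (by
      intro x hx y hy hxy
      simp only [Finset.coe_image, Finset.coe_univ, Set.image_univ, Set.mem_range] at hx hy
      obtain ⟨i, rfl⟩ := hx
      obtain ⟨j, rfl⟩ := hy
      rw [hfψ, hfψ] at hxy
      exact hψ' hxy)
  refine ⟨ρ.trans (Equiv.subtypeUnivEquiv Finset.mem_univ), ψ, ?_, ?_, ?_⟩
  · intro i j hij
    change (r i).card ≤ (r j).card
    refine Finset.card_le_card fun x hx => ?_
    simp only [r, Finset.mem_filter] at hx ⊢
    exact ⟨hx.1, hx.2.trans_le (hχ hij)⟩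
  · intro i j hij
    have hsub : r j ⊆ r i ∪ (Finset.Ico i j).image χ := by
      intro x hx
      simp only [r, Finset.mem_filter, Finset.mem_image, Finset.mem_univ, true_and] at hx
      obtain ⟨⟨t, rfl⟩, ht⟩ := hx
      by_cases h : χ t < χ i
      · simp [r, h]
      · refine Finset.mem_union_right _ ?_
        rcases le_total i t with h' | h'
        · refine Finset.mem_image_of_mem _ (Finset.mem_Ico.2 ⟨h', ?_⟩)
          by_contra hjt
          exact absurd (hχ (not_lt.1 hjt)) (not_le.2 ht)
        · -- here `χ t = χ i`
          refine Finset.mem_image.2 ⟨i, Finset.mem_Ico.2 ⟨le_rfl, ?_⟩,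
            le_antisymm (not_lt.1 h) (hχ h')⟩
          by_contra hji
          exact absurd (hχ (not_lt.1 hji)) (not_le.2 (ht.trans_le' (not_lt.1 h)))
    calc (r j).card ≤ (r i ∪ (Finset.Ico i j).image χ).card := Finset.card_le_card hsub
      _ ≤ (r i).card + ((Finset.Ico i j).image χ).card := Finset.card_union_le _ _
      _ ≤ (r i).card + (j - i) := by
        refine Nat.add_le_add_left (Finset.card_image_le.trans ?_) _
        rw [Fin.card_Ico]
  · ext i
    have := hρ (ψ i) (Finset.mem_image_of_mem _ (Finset.mem_univ _))
    simp [this, hfψ]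

/-- Sort the outputs by source, copy monotonically, and bring the sources into place. -/
lemma gather_mem {F : Type*} [Field F] [StarRing F] {m : ℕ} (φ : Fin (2 ^ m) → Fin (2 ^ m)) :
    gather F φ ∈ BBStarPow F 3 (2 ^ m) := by
  obtain ⟨ρ, ψ, hmono, hlip, h⟩ :=
    exists_perm_comp_lipschitz (φ ∘ Tuple.sort φ) (Tuple.monotone_sort φ)
  obtain ⟨A, hA, hψ⟩ := exists_ladder_of_monotone (F := F) ψ hmono hlip
  have hψ' : gather F ψ ∈ BBStar F (2 ^ m) := by
    rw [hψ, ← one_mul A.conjTranspose]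
    exact (Ladder.one m).mul_conjTranspose_mem hA
  have hφ : φ = ρ ∘ ψ ∘ ((Tuple.sort φ)⁻¹ : Equiv.Perm (Fin (2 ^ m))) := by
    rw [← Function.comp_assoc, ← h]
    ext i
    simp
  rw [hφ, ← Function.comp_assoc, ← gather_mul, ← gather_mul]
  exact BBStarPow.mul (.of_mem (gather_perm_mem _)) (BBStarPow.mul (.of_mem hψ')
    (.of_mem (gather_perm_mem ρ)))

/-! ### Sparse matrices -/

/-- A linear map each of whose coordinates on the lower half combines two input coordinates:
gather the first operands into the lower and the second operands into the upper half, then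
combine with a single factor of full block size. -/
lemma exists_combination {F : Type*} [Field F] [StarRing F] {m : ℕ} (α β : Fin (2 ^ (m + 1)) → F)
    (f g : Fin (2 ^ (m + 1)) → Fin (2 ^ (m + 1))) :
    ∃ L ∈ BBStarPow F 4 (2 ^ (m + 1)), ∀ (x : Fin (2 ^ (m + 1)) → F) (i : Fin (2 ^ (m + 1))),
      (i : ℕ) < 2 ^ m → L.mulVec x i = α i * x (f i) + β i * x (g i) := by
  have hm : 2 ^ (m + 1) = 2 ^ m + 2 ^ m := by ring
  let φ : Fin (2 ^ (m + 1)) → Fin (2 ^ (m + 1)) := fun i =>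
    if (i : ℕ) < 2 ^ m then f i else g ⟨i - 2 ^ m, by omega⟩
  let T : Matrix (Fin (2 ^ (m + 1))) (Fin (2 ^ (m + 1))) F := Matrix.of fun i j =>
    if j = i then α i else if (j : ℕ) = i + 2 ^ m then β i else 0
  have hT : IsSwitchMatrix m T := by
    intro i j h
    have hij : j = i ∨ (j : ℕ) = i + 2 ^ m := by
      by_contra hne
      push Not at hne
      exact h (by simp [T, hne.1, hne.2])
    refine ⟨by rw [Nat.div_eq_of_lt i.2, Nat.div_eq_of_lt j.2], ?_⟩
    rcases hij with rfl | hij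
    · rfl
    · simp [hij]
  have hTB : T ∈ BBStar F (2 ^ (m + 1)) := by
    have := (Ladder.succ hT (Ladder.one m)).mul_conjTranspose_mem (Ladder.one (m + 1))
    simpa using this
  refine ⟨T * gather F φ, BBStarPow.mul (.of_mem hTB) (gather_mem φ), fun x i hi => ?_⟩
  rw [← Matrix.mulVec_mulVec, gather_mulVec]
  let i' : Fin (2 ^ (m + 1)) := ⟨i + 2 ^ m, by omega⟩
  have hpos : 0 < 2 ^ m := by positivity
  have hne : i ≠ i' := fun h => by
    have := congrArg Fin.val h
    simp only [i'] at this
    omega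
  have hsum : T.mulVec (x ∘ φ) i = T i i * x (φ i) + T i i' * x (φ i') := by
    refine Fintype.sum_eq_add i i' hne fun j hj => ?_
    have h2 : (j : ℕ) ≠ i + 2 ^ m := fun h => hj.2 (Fin.ext h)
    simp [T, hj.1, h2]
  have h1 : T i i = α i := by simp [T]
  have h2 : T i i' = β i := by simp [T, hne.symm, i']
  have h3 : φ i = f i := by simp [φ, hi]
  have h4 : φ i' = g i := by simp [φ, i']
  rw [hsum, h1, h2, h3, h4]

end Kaleidoscope

/-! ### Simulation of circuits -/

namespace LinearCircuit

/-- The nodes available as operands of gate `i`, as nodes of the whole circuit. -/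
def operandNode {F : Type*} {n : ℕ} (C : LinearCircuit F n) (i : Fin C.numGates) :
    Fin n ⊕ Fin i.val → Fin n ⊕ Fin C.numGates :=
  Sum.map id (Fin.castLE i.2.le)

lemma gateVal_eq {F : Type*} [Field F] {n : ℕ} (C : LinearCircuit F n) (v : Fin n → F)
    (i : Fin C.numGates) :
    C.gateVal v i = C.α i * Sum.elim v (C.gateVal v) (C.operandNode i (C.left i)) +
      C.β i * Sum.elim v (C.gateVal v) (C.operandNode i (C.right i)) := by
  rw [gateVal]
  cases C.left i <;> cases C.right i <;> rfl

lemma gateDepth_eq {F : Type*} {n : ℕ} (C : LinearCircuit F n) (i : Fin C.numGates) :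
    C.gateDepth i = 1 + max (Sum.elim 0 C.gateDepth (C.operandNode i (C.left i)))
      (Sum.elim 0 C.gateDepth (C.operandNode i (C.right i))) := by
  rw [gateDepth]
  cases C.left i <;> cases C.right i <;> rfl

end LinearCircuit

namespace Kaleidoscope

/-- One and the same matrix `L` recomputes all gates from the current values of their operands
(and keeps the inputs). After `t` applications the gates of depth at most `t` are correct. -/
lemma exists_simulation {F : Type*} [Field F] [StarRing F] {n m : ℕ} (C : LinearCircuit F n)
    (hs : C.size ≤ 2 ^ m) :
    ∃ E ∈ BBStarPow F (4 * C.depth + 3) (2 ^ (m + 1)),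
      ∀ (v : Fin n → F) (x : Fin (2 ^ (m + 1)) → F),
        (∀ (j : Fin n) (i : Fin (2 ^ (m + 1))), (i : ℕ) = j → x i = v j) →
        ∀ (j : Fin n) (i : Fin (2 ^ (m + 1))), (i : ℕ) = j → E.mulVec x i = C.eval v j := by
  have hm : 2 ^ (m + 1) = 2 ^ m + 2 ^ m := by ring
  have hs' : n + C.numGates ≤ 2 ^ m := hs
  let slot : Fin n ⊕ Fin C.numGates → Fin (2 ^ (m + 1)) := fun z =>
    Fin.castLE (by omega) (finSumFinEquiv z)
  have hslot : Function.Injective slot :=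
    (Fin.castLE_injective _).comp finSumFinEquiv.injective
  have hslot_lt (z) : (slot z : ℕ) < 2 ^ m := (finSumFinEquiv z).2.trans_le hs'
  let f := Function.extend slot
    (Sum.elim (slot ∘ Sum.inl) fun k => slot (C.operandNode k (C.left k))) id
  let g := Function.extend slot
    (Sum.elim (slot ∘ Sum.inl) fun k => slot (C.operandNode k (C.right k))) id
  let α := Function.extend slot (Sum.elim 1 C.α) 0
  let β := Function.extend slot (Sum.elim 0 C.β) 0
  obtain ⟨L, hL, hLx⟩ := exists_combination α β f g
  let out : Fin (2 ^ (m + 1)) → Fin (2 ^ (m + 1)) :=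
    Function.extend (slot ∘ Sum.inl) (slot ∘ C.out) id
  refine ⟨gather F out * L ^ C.depth, BBStarPow.mul (gather_mem out) (BBStarPow.pow hL _),
    fun v x hx j i hij => ?_⟩
  have hinv (t : ℕ) (z : Fin n ⊕ Fin C.numGates) (hz : Sum.elim (0 : Fin n → ℕ) C.gateDepth z ≤ t) :
      (L ^ t).mulVec x (slot z) = Sum.elim v (C.gateVal v) z := by
    induction t generalizing z with
    | zero =>
      rcases z with j | k
      · simpa using hx j _ (by simp [slot])
      · rw [Sum.elim_inr, C.gateDepth_eq] at hz
        omega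
    | succ t ih =>
      rw [pow_succ' L, ← Matrix.mulVec_mulVec, hLx _ _ (hslot_lt z)]
      simp only [f, g, α, β, hslot.extend_apply]
      rcases z with j | k
      · have := ih (Sum.inl j) (by simp)
        simpa using this
      · rw [Sum.elim_inr, C.gateDepth_eq] at hz
        simp only [Sum.elim_inr]
        rw [C.gateVal_eq, ih _ (by omega), ih _ (by omega)]
  obtain rfl : slot (Sum.inl j) = i := Fin.ext (by simp [slot, hij])
  rw [← Matrix.mulVec_mulVec, gather_mulVec, Function.comp_apply]
  have hout : out (slot (Sum.inl j)) = slot (C.out j) :=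
    (hslot.comp Sum.inl_injective).extend_apply _ _ j
  rw [hout]
  refine hinv _ _ ?_
  rcases C.out j with j' | k
  · simp
  · exact Finset.le_sup (f := C.gateDepth) (Finset.mem_univ k)

end Kaleidoscope

theorem mainTheorem1 :
    ∃ K : ℕ, ∀ (F : Type*) [Field F] [StarRing F] (n : ℕ) (_hn : 0 < n)
      (M : Matrix (Fin n) (Fin n) F) (C : LinearCircuit F n) (_hC : C.Computes M),
      ∃ (w : ℕ) (e : ℚ),
        1 ≤ w ∧ w ≤ K * max 1 C.depth ∧ e ≤ K * ((C.size : ℚ) / n) ∧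
          M ∈ Kaleidoscope.KMatrix F n w e := by
  -- `4 d + 3 ≤ 8 max 1 d` factors suffice, in size at most `4` times that of the circuit
  refine ⟨8, fun F _ _ n hn M C hC => ?_⟩
  have hpos : 0 < C.size := Nat.add_pos_left hn _
  -- `2 ^ m` is the least power of two that is at least the size
  obtain ⟨m, hm, hm'⟩ : ∃ m : ℕ, C.size ≤ 2 ^ m ∧ 2 ^ (m + 1) ≤ 4 * C.size := by
    refine ⟨Nat.clog 2 C.size, Nat.le_pow_clog one_lt_two _, ?_⟩
    rcases Nat.lt_or_ge 1 C.size with h | h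
    · have h1 := Nat.pow_pred_clog_lt_self one_lt_two h
      have h2 : 0 < Nat.clog 2 C.size := Nat.clog_pos one_lt_two h
      obtain ⟨c, hc⟩ := Nat.exists_eq_add_of_lt h2
      rw [hc] at h1 ⊢
      simp only [zero_add, Nat.pred_eq_sub_one, Nat.add_sub_cancel, pow_succ] at h1 ⊢
      omega
    · rw [Nat.clog_of_right_le_one h]
      omega
  obtain ⟨E, hE, hEx⟩ := Kaleidoscope.exists_simulation C hm
  have hn' : (0 : ℚ) < n := by exact_mod_cast hn
  have hnN : n ≤ 2 ^ (m + 1) := by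
    have h1 : n ≤ C.size := Nat.le_add_right _ _
    have h2 : 2 ^ (m + 1) = 2 ^ m + 2 ^ m := by ring
    omega
  refine ⟨4 * C.depth + 3, (2 ^ (m + 1) : ℕ) / n, by omega, by omega, ?_, 2 ^ (m + 1),
    by field_simp, hnN, E, hE, ?_⟩
  · rw [← mul_div_assoc]
    gcongr
    have : 2 ^ (m + 1) ≤ 8 * C.size := by omega
    exact_mod_cast this
  · refine Matrix.ext_of_mulVec_single fun k => ?_
    ext j
    rw [← hC, ← Matrix.mulVec_mulVec, ← Matrix.mulVec_mulVec]
    set v : Fin n → F := Pi.single k 1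
    have hS (y : Fin (2 ^ (m + 1)) → F) (j : Fin n) :
        (Kaleidoscope.cornerMatrix F n (2 ^ (m + 1))).mulVec y j = y (Fin.castLE hnN j) := by
      have h0 (i : Fin (2 ^ (m + 1))) : (j : ℕ) = i ↔ Fin.castLE hnN j = i := by
        simp [Fin.ext_iff]
      simp [Kaleidoscope.cornerMatrix, Matrix.mulVec, dotProduct, h0]
    have hST (j : Fin n) (i : Fin (2 ^ (m + 1))) (hij : (i : ℕ) = j) :
        (Kaleidoscope.cornerMatrix F n (2 ^ (m + 1))).transpose.mulVec v i = v j := by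
      have h0 (j' : Fin n) : (j' : ℕ) = i ↔ j = j' := by
        rw [hij, Fin.ext_iff, eq_comm]
      simp [Kaleidoscope.cornerMatrix, Matrix.mulVec, dotProduct, h0]
    rw [hS]
    exact (hEx v _ hST j _ rfl).symm
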